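/- There is an absolute constant $c>0$ such that the following holds. For all real $q\in(2,\infty)$, all integers $d\ge 2$ and all $\varepsilon>0$, $\ell_q$ mean estimation in $\mathbb R^d$ with error $\varepsilon$ can be solved by a deterministic non-adaptive statistical query algorithm using at most $3d\log_2 d$ queries to $\mathrm{STAT}(c\,\varepsilon/\log_2 d)$. That is, there are an integer $m\le 3d\log_2 d$, measurable queries $\phi_1,\dots,\phi_m:\mathcal B_q^d\to[-1,1]$ and a map $g:\mathbb R^m\to\mathbb R^d$ (depending only on $q,d,\varepsilon$) such that for every probability distribution $D$ on the unit ball $\mathcal B_q^d=\{w\in\mathbb R^d:\|w\|_q\le 1\}$ and all answers $v_1,\dots,v_m\in\mathbb R$ with $$\bigl|v_i-\mathbb E_{w\sim D}[\phi_i(w)]\bigr|\le \frac{c\,\varepsilon}{\log_2 d}\qquad(1\le i\le m),$$ one has $$\bigl\|\,\mathbb E_{w\sim D}[w]-g(v_1,\dots,v_m)\bigr\|_q\le\varepsilon .$$ -/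

import Mathlib

open MeasureTheory
open scoped ENNReal

/-- A (deterministic, possibly adaptive) statistical query algorithm that asks `m` queries about an
unknown distribution over the domain `X` and outputs an element of `α`.  The `i`-th query is a
measurable function `X → [-1, 1]`, chosen from the answers to the queries before it; the output is
computed from the answers to all `m` queries. -/
structure SQAlgorithm (X : Type*) [MeasurableSpace X] (α : Type*) (m : ℕ) where
  /-- the `i`-th query, given the answers to the earlier ones -/
  query : (i : Fin m) → (Fin (i : ℕ) → ℝ) → X → ℝ
  measurable_query : ∀ i a, Measurable (query i a)
  query_mem : ∀ i a x, query i a x ∈ Set.Icc (-1 : ℝ) 1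
  /-- the output, given all the answers -/
  output : (Fin m → ℝ) → α

/-- `v` is a value that the oracle `STAT_D(τ)` may return on the query `φ`. -/
def IsSTATAnswer {X : Type*} [MeasurableSpace X] (D : Measure X) (τ : ℝ) (φ : X → ℝ) (v : ℝ) :
    Prop :=
  |v - ∫ x, φ x ∂D| ≤ τ

namespace SQAlgorithm

variable {X : Type*} [MeasurableSpace X] {α : Type*} {m : ℕ}

/-- The queries are fixed in advance: they do not depend on the answers to earlier queries. -/
def NonAdaptive (A : SQAlgorithm X α m) : Prop :=
  ∀ i a a', A.query i a = A.query i a'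

/-- `v` is a possible sequence of answers in a run of `A` with access to `STAT_D(τ)`. -/
def IsTranscript (A : SQAlgorithm X α m) (D : Measure X) (τ : ℝ) (v : Fin m → ℝ) : Prop :=
  ∀ i : Fin m, IsSTATAnswer D τ (A.query i fun j => v (Fin.castLE i.isLt.le j)) (v i)

end SQAlgorithm

/-- `A` solves the mean estimation problem in the norm of `E` with error `ε`, using queries to
`STAT(τ)`: for every distribution `D` over the unit ball of `E`, and whatever answers the oracle
`STAT_D(τ)` gives, the output is within `ε` of the mean of `D`. -/
def SQAlgorithm.SolvesMeanEstimation {E : Type*} [NormedAddCommGroup E] [NormedSpace ℝ E]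
    [MeasurableSpace E] {m : ℕ} (A : SQAlgorithm (Metric.closedBall (0 : E) 1) E m)
    (τ ε : ℝ) : Prop :=
  ∀ D : Measure (Metric.closedBall (0 : E) 1), IsProbabilityMeasure D →
    ∀ v : Fin m → ℝ, A.IsTranscript D τ v → ‖(∫ w, (w : E) ∂D) - A.output v‖ ≤ ε

/-! Estimating each coordinate of the mean controls the error in `ℓ_∞`. Kashin's theorem controls it
in `ℓ₂`: there are `C d` vectors `e i` such that every `w` in the Euclidean ball is `∑ a i • e i`
with `|a i| ≤ 1`, while coefficient errors of size `t` move the sum by at most `K t`. So queries to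
the `a i` estimate a mean in `ℓ₂` up to a constant times the tolerance.

For `ℓ_q`, cut `w` by coordinate size into bands `(s, ρ s]` with constant ratio `ρ`. At most `s ^
(-q)` coordinates of a band are nonzero, so its `ℓ₂` norm is at most `ρ s * s ^ (-q/2)`. With
tolerance `η`, the errors are `ρ s η` in `ℓ_∞` and `K ρ s * s ^ (-q/2) * η` in `ℓ₂`; in `‖f‖_q ^ q ≤
‖f‖_∞ ^ (q-2) * ‖f‖₂ ^ 2` the powers of `s` cancel, leaving at most `K ρ η` for every `q > 2`
(`norm_band_mean_sub_le`). After order `log d` bands the remaining coordinates are `O(1/√d)` and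
coordinate queries suffice (`norm_cutoff_mean_sub_le`). Summing over bands costs the factor `log d`
in the tolerance.

Kashin's theorem comes from random signs, a union bound over a net of the sphere, and duality
(`exists_signs_two_sided`, `exists_coeff_of_frame`). -/

/-! ### Exponential moments of random sign sums -/

/-- The linear form with random signs `s` evaluated at `y`. -/
def signForm {d : ℕ} (s : Fin d → Bool) (y : Fin d → ℝ) : ℝ :=
  ∑ j, (if s j then 1 else -1) * y j

theorem sum_exp_signForm {d : ℕ} (y : Fin d → ℝ) :
    ∑ s : Fin d → Bool, Real.exp (signForm s y) = ∏ j, (2 * Real.cosh (y j)) := by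
  have h := Fintype.prod_sum (fun (j : Fin d) (b : Bool) =>
    Real.exp ((if b then (1 : ℝ) else -1) * y j))
  simp only [signForm, Real.exp_sum]
  rw [← h]
  refine Finset.prod_congr rfl fun j _ => ?_
  simp [Real.cosh_eq]
  ring

theorem sum_cos_signForm {d : ℕ} (y : Fin d → ℝ) :
    ∑ s : Fin d → Bool, Real.cos (signForm s y) = ∏ j, (2 * Real.cos (y j)) := by
  have h := Fintype.prod_sum (fun (j : Fin d) (b : Bool) =>
    Complex.exp (((if b then (1 : ℂ) else -1) * y j) * Complex.I))
  have h2 : ∀ s : Fin d → Bool, ∏ j, Complex.exp (((if s j then (1 : ℂ) else -1) * y j) * Complex.I)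
      = Complex.exp ((signForm s y : ℝ) * Complex.I) := by
    intro s
    rw [← Complex.exp_sum, ← Finset.sum_mul]
    congr 2
    simp only [signForm]
    push_cast
    refine Finset.sum_congr rfl fun j _ => ?_
    split_ifs <;> simp
  have h3 : ∀ j, ∑ b : Bool, Complex.exp (((if b then (1 : ℂ) else -1) * y j) * Complex.I)
      = ((2 * Real.cos (y j) : ℝ) : ℂ) := by
    intro j
    push_cast
    rw [Complex.two_cos]
    simp
  simp only [h2, h3] at h
  have h4 := congrArg Complex.re h
  rw [← Complex.ofReal_prod, Complex.ofReal_re, Complex.re_sum] at h4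
  simp only [Complex.exp_ofReal_mul_I_re] at h4
  exact h4.symm

theorem sum_exp_abs_signForm_le {d : ℕ} (y : Fin d → ℝ) (hy : ∑ j, y j ^ 2 = 1) :
    ∑ s : Fin d → Bool, Real.exp |signForm s y| ≤ 4 * 2 ^ d := by
  have key : ∀ z : Fin d → ℝ, ∑ j, z j ^ 2 = 1 →
      ∑ s : Fin d → Bool, Real.exp (signForm s z) ≤ 2 * 2 ^ d := by
    intro z hz
    rw [sum_exp_signForm, Finset.prod_mul_distrib]
    simp only [Finset.prod_const, Finset.card_univ, Fintype.card_fin]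
    rw [mul_comm]
    gcongr
    calc ∏ j, Real.cosh (z j) ≤ ∏ j, Real.exp (z j ^ 2 / 2) :=
          Finset.prod_le_prod (fun j _ => (Real.cosh_pos _).le)
            fun j _ => Real.cosh_le_exp_half_sq _
      _ = Real.exp (1 / 2) := by rw [← Real.exp_sum, ← Finset.sum_div, hz]
      _ ≤ 2 := by
          have := Real.exp_bound_div_one_sub_of_interval (x := 1 / 2) (by norm_num) (by norm_num)
          norm_num at this ⊢
          exact this
  have h1 := key y hy
  have h2 := key (fun j => -y j) (by simpa using hy)
  have h3 : ∀ s, Real.exp |signForm s y| ≤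
      Real.exp (signForm s y) + Real.exp (signForm s fun j => -y j) := by
    intro s
    have : (signForm s fun j => -y j) = -signForm s y := by simp [signForm]
    rw [this]
    rcases abs_cases (signForm s y) with h | h <;> rw [h.1] <;>
      linarith [Real.exp_pos (signForm s y), Real.exp_pos (-signForm s y)]
  calc _ ≤ _ := Finset.sum_le_sum fun s _ => h3 s
    _ ≤ _ := by rw [Finset.sum_add_distrib]; linarith

/-- Trades `exp (-|u|)` for a cosine, whose sum over signs factorizes; this yields the lower tail
without a separate anti-concentration argument. -/
theorem exp_neg_le_cos {u : ℝ} (hu : 0 ≤ u) : Real.exp (-u) ≤ 3 / 4 + Real.cos u / 4 := by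
  have h1 : Real.exp (-u) ≤ 1 / (1 + u) := by
    rw [Real.exp_neg, ← one_div]
    gcongr
    linarith [Real.add_one_le_exp u]
  rcases le_total u 1 with h | h
  · have h2 := Real.one_sub_sq_div_two_le_cos (x := u)
    have h3 : 1 / (1 + u) ≤ 1 - u / 2 := by
      rw [div_le_iff₀ (by linarith)]
      nlinarith
    nlinarith
  · have h2 := Real.neg_one_le_cos u
    have h3 : 1 / (1 + u) ≤ 1 / 2 := by gcongr; linarith
    linarith

/-- Each `|y j| ≤ 1`, and there `cos u ≤ exp (-u ^ 2 / 5)`. -/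
theorem prod_cos_le {d : ℕ} (y : Fin d → ℝ) (hy : ∑ j, y j ^ 2 = 1) :
    ∏ j, Real.cos (y j) ≤ 5 / 6 := by
  have habs : ∀ j, |y j| ≤ 1 := by
    intro j
    rw [← sq_le_one_iff_abs_le_one, ← hy]
    exact Finset.single_le_sum (f := fun j => y j ^ 2) (fun i _ => sq_nonneg _) (Finset.mem_univ j)
  have hpi := Real.pi_gt_three
  have hpi2 : (1 : ℝ) / 5 ≤ 2 / Real.pi ^ 2 := by
    have := Real.pi_lt_d2
    rw [div_le_div_iff₀ (by norm_num) (by positivity)]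
    nlinarith
  calc ∏ j, Real.cos (y j) ≤ ∏ j, Real.exp (-(y j ^ 2 / 5)) := by
        refine Finset.prod_le_prod (fun j _ => ?_) fun j _ => ?_
        · apply Real.cos_nonneg_of_neg_pi_div_two_le_of_le <;>
            linarith [(abs_le.1 (habs j)).1, (abs_le.1 (habs j)).2]
        · have h1 := Real.cos_le_one_sub_mul_cos_sq (x := y j) (by linarith [habs j])
          have h2 := Real.add_one_le_exp (-(y j ^ 2 / 5))
          nlinarith [sq_nonneg (y j)]
    _ = Real.exp (-(1 / 5)) := by
        rw [← Real.exp_sum, Finset.sum_neg_distrib, ← Finset.sum_div, hy]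
    _ ≤ 5 / 6 := by
        rw [Real.exp_neg, inv_le_comm₀ (Real.exp_pos _) (by norm_num)]
        linarith [Real.add_one_le_exp (1 / 5 : ℝ)]

/-- The constant is `3/4 + (5/6)/4 = 23/24`. -/
theorem sum_exp_neg_abs_signForm_le {d : ℕ} (y : Fin d → ℝ) (hy : ∑ j, y j ^ 2 = 1) :
    ∑ s : Fin d → Bool, Real.exp (-|signForm s y|) ≤ 23 / 24 * 2 ^ d := by
  have h1 : ∑ s : Fin d → Bool, Real.cos (signForm s y) ≤ 5 / 6 * 2 ^ d := by
    rw [sum_cos_signForm, Finset.prod_mul_distrib]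
    simp only [Finset.prod_const, Finset.card_univ, Fintype.card_fin]
    rw [mul_comm]
    gcongr
    exact prod_cos_le y hy
  calc ∑ s : Fin d → Bool, Real.exp (-|signForm s y|)
      ≤ ∑ s : Fin d → Bool, (3 / 4 + Real.cos (signForm s y) / 4) := by
        refine Finset.sum_le_sum fun s _ => ?_
        have := exp_neg_le_cos (abs_nonneg (signForm s y))
        rwa [Real.cos_abs] at this
    _ ≤ _ := by
        have hc : ∑ _s : Fin d → Bool, (3 / 4 : ℝ) = 2 ^ d * (3 / 4) := by simp
        rw [Finset.sum_add_distrib, hc, ← Finset.sum_div]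
        linarith

/-! ### Kashin's theorem: union bound over a net -/

/-- If the failure bounds add up to less than one over a finite set of unit vectors, some choice of
sign vectors satisfies two-sided `ℓ₁` bounds on all of them. -/
theorem exists_signs_of_finset {d N : ℕ} (S : Finset (EuclideanSpace ℝ (Fin d)))
    (hS : ∀ y ∈ S, ‖y‖ = 1) (hcard : (S.card : ℝ) * ((46 / 47) ^ N + (1 / 2) ^ N) < 1) :
    ∃ r : Fin N → Fin d → Bool, ∀ y ∈ S,
      (N : ℝ) / 48 ≤ ∑ i, |signForm (r i) y| ∧ ∑ i, |signForm (r i) y| ≤ 3 * N := by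
  set P : (Fin N → Fin d → Bool) → EuclideanSpace ℝ (Fin d) → ℝ :=
    fun r y => ∑ i, |signForm (r i) y| with hP
  -- Chernoff weights: each exponential is at least `1` when its bound fails, so `F r y < 1` gives
  -- both bounds.
  set F : (Fin N → Fin d → Bool) → EuclideanSpace ℝ (Fin d) → ℝ :=
    fun r y => Real.exp (N / 48 - P r y) + Real.exp (P r y - 3 * N) with hF
  have hsq : ∀ y ∈ S, ∑ j, y j ^ 2 = 1 := by
    intro y hy
    rw [← EuclideanSpace.real_norm_sq_eq, hS y hy, one_pow]
  -- Per sign vector, the lower tail contributes `48/47 * 23/24 = 46/47`.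
  have e1 : Real.exp (1 / 48 : ℝ) ≤ 48 / 47 := by
    have := Real.exp_bound_div_one_sub_of_interval (x := 1 / 48) (by norm_num) (by norm_num)
    norm_num at this ⊢
    exact this
  -- Per sign vector, the upper tail contributes `1/8 * 4 = 1/2`.
  have e3 : Real.exp (-3 : ℝ) ≤ 1 / 8 := by
    rw [Real.exp_neg, inv_le_comm₀ (Real.exp_pos _) (by norm_num)]
    have h1 := Real.exp_one_gt_d9
    have h2 : Real.exp 3 = Real.exp 1 ^ 3 := by rw [← Real.exp_nat_mul]; norm_num
    rw [h2]
    have : (2 : ℝ) ^ 3 ≤ Real.exp 1 ^ 3 := by gcongr; linarith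
    norm_num at this ⊢
    exact this
  have hsum : ∀ y ∈ S, ∑ r, F r y ≤ ((46 / 47) ^ N + (1 / 2) ^ N) * (2 ^ d) ^ N := by
    intro y hy
    rw [Finset.sum_add_distrib, add_mul]
    have a1 : ∑ r, Real.exp (N / 48 - P r y) ≤ (46 / 47) ^ N * (2 ^ d) ^ N := by
      have : ∀ r, Real.exp (N / 48 - P r y) =
          Real.exp (1 / 48) ^ N * ∏ i, Real.exp (-|signForm (r i) y|) := by
        intro r
        rw [← Real.exp_sum, ← Real.exp_nat_mul, ← Real.exp_add, Finset.sum_neg_distrib]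
        congr 1
        simp only [hP]; ring
      simp only [this]
      rw [← Finset.mul_sum, ← Fintype.sum_pow (fun s : Fin d → Bool => Real.exp (-|signForm s y|)),
        ← mul_pow, ← mul_pow]
      apply pow_le_pow_left₀ (by positivity)
      calc _ ≤ 48 / 47 * (23 / 24 * 2 ^ d) :=
            mul_le_mul e1 (sum_exp_neg_abs_signForm_le _ (hsq y hy)) (by positivity) (by norm_num)
        _ = _ := by ring
    have a2 : ∑ r, Real.exp (P r y - 3 * N) ≤ (1 / 2) ^ N * (2 ^ d) ^ N := by
      have : ∀ r, Real.exp (P r y - 3 * N) =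
          Real.exp (-3) ^ N * ∏ i, Real.exp (|signForm (r i) y|) := by
        intro r
        rw [← Real.exp_sum, ← Real.exp_nat_mul, ← Real.exp_add]
        congr 1
        simp only [hP]; ring
      simp only [this]
      rw [← Finset.mul_sum, ← Fintype.sum_pow (fun s : Fin d → Bool => Real.exp (|signForm s y|)),
        ← mul_pow, ← mul_pow]
      apply pow_le_pow_left₀ (by positivity)
      calc _ ≤ 1 / 8 * (4 * 2 ^ d) :=
            mul_le_mul e3 (sum_exp_abs_signForm_le _ (hsq y hy)) (by positivity) (by norm_num)
        _ = _ := by ring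
    linarith
  have hlt : ∑ r, ∑ y ∈ S, F r y < ∑ r : Fin N → Fin d → Bool, (1 : ℝ) := by
    rw [Finset.sum_comm]
    calc _ ≤ ∑ y ∈ S, ((46 / 47) ^ N + (1 / 2) ^ N) * ((2 : ℝ) ^ d) ^ N := Finset.sum_le_sum hsum
      _ = ((S.card : ℝ) * ((46 / 47) ^ N + (1 / 2) ^ N)) * (2 ^ d) ^ N := by
          rw [Finset.sum_const, nsmul_eq_mul]; ring
      _ < 1 * (2 ^ d) ^ N := by gcongr
      _ = _ := by simp
  obtain ⟨r, -, hr⟩ := Finset.exists_lt_of_sum_lt hlt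
  refine ⟨r, fun y hy => ?_⟩
  have h1 : F r y < 1 := lt_of_le_of_lt
    (Finset.single_le_sum (f := fun y => F r y) (fun z _ => by positivity) hy) hr
  have p1 := Real.exp_pos (N / 48 - P r y)
  have p2 := Real.exp_pos (P r y - 3 * N)
  have q1 : Real.exp (N / 48 - P r y) < 1 := by simp only [hF] at h1; linarith
  have q2 : Real.exp (P r y - 3 * N) < 1 := by simp only [hF] at h1; linarith
  rw [Real.exp_lt_one_iff] at q1 q2
  exact ⟨by linarith, by linarith⟩

/-- Volume comparison: the disjoint balls of radius `δ / 2` lie in the ball of radius `1 + δ / 2`.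
-/
theorem card_le_of_separated_unit_ball {E : Type*} [NormedAddCommGroup E] [NormedSpace ℝ E]
    [FiniteDimensional ℝ E] {δ : ℝ} (hδ : 0 < δ) (s : Finset E) (hs : ∀ c ∈ s, ‖c‖ ≤ 1)
    (h : ∀ c ∈ s, ∀ d ∈ s, c ≠ d → δ ≤ ‖c - d‖) :
    (s.card : ℝ) ≤ (1 + 2 / δ) ^ Module.finrank ℝ E := by
  borelize E
  let μ : Measure E := Measure.addHaar
  have D : Set.Pairwise (s : Set E)
      (Function.onFun Disjoint fun c => Metric.ball (c : E) (δ / 2)) := by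
    rintro c hc d hd hcd
    apply Metric.ball_disjoint_ball
    rw [dist_eq_norm]
    linarith [h c hc d hd hcd]
  have hsub : (⋃ c ∈ s, Metric.ball (c : E) (δ / 2)) ⊆ Metric.ball (0 : E) (1 + δ / 2) := by
    refine Set.iUnion₂_subset fun x hx => Metric.ball_subset_ball' ?_
    rw [dist_zero_right]
    linarith [hs x hx]
  have I : (s.card : ℝ≥0∞) * ENNReal.ofReal ((δ / 2) ^ Module.finrank ℝ E) * μ (Metric.ball 0 1) ≤
      ENNReal.ofReal ((1 + δ / 2) ^ Module.finrank ℝ E) * μ (Metric.ball 0 1) := by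
    rw [← μ.addHaar_ball_of_pos (0 : E) (by positivity : 0 < 1 + δ / 2)]
    refine le_trans (le_of_eq ?_) (measure_mono hsub)
    rw [measure_biUnion_finset D fun c _ => measurableSet_ball]
    simp only [μ.addHaar_ball_of_pos _ (by positivity : 0 < δ / 2), Finset.sum_const, nsmul_eq_mul,
      mul_assoc]
  have J := (ENNReal.mul_le_mul_iff_left (Metric.measure_ball_pos μ (0 : E) zero_lt_one).ne'
    measure_ball_lt_top.ne).1 I
  have K := ENNReal.toReal_le_of_le_ofReal (by positivity) J
  rw [ENNReal.toReal_mul, ENNReal.toReal_natCast, ENNReal.toReal_ofReal (by positivity),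
    ← le_div_iff₀ (by positivity), ← div_pow] at K
  convert! K using 2
  field_simp
  ring

/-- A separated subset of the sphere of maximal cardinality is a net. -/
theorem exists_net_sphere (d : ℕ) {δ : ℝ} (hδ : 0 < δ) :
    ∃ S : Finset (EuclideanSpace ℝ (Fin d)), (∀ y ∈ S, ‖y‖ = 1) ∧
      (S.card : ℝ) ≤ (1 + 2 / δ) ^ d ∧ ∀ x, ‖x‖ = 1 → ∃ y ∈ S, ‖x - y‖ < δ := by
  classical
  let Q : Finset (EuclideanSpace ℝ (Fin d)) → Prop := fun s =>
    (∀ c ∈ s, ‖c‖ = 1) ∧ ∀ c ∈ s, ∀ d ∈ s, c ≠ d → δ ≤ ‖c - d‖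
  have hQ : ∀ s, Q s → (s.card : ℝ) ≤ (1 + 2 / δ) ^ d := by
    intro s hs
    have := card_le_of_separated_unit_ball hδ s (fun c hc => (hs.1 c hc).le) hs.2
    simpa using this
  let p : ℕ → Prop := fun n => ∃ s, Q s ∧ s.card = n
  obtain ⟨b, hb⟩ := exists_nat_ge ((1 + 2 / δ) ^ d)
  have h0 : p 0 := ⟨∅, ⟨by simp, by simp⟩, rfl⟩
  obtain ⟨S, hS, hcard⟩ : p (Nat.findGreatest p b) := Nat.findGreatest_spec (Nat.zero_le b) h0
  refine ⟨S, hS.1, hQ S hS, fun x hx => ?_⟩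
  by_contra! hcon
  have hxS : x ∉ S := by
    intro hxS
    have := hcon x hxS
    simp at this
    linarith
  have hQ' : Q (insert x S) := by
    constructor
    · intro c hc
      rcases Finset.mem_insert.1 hc with rfl | hc
      · exact hx
      · exact hS.1 c hc
    · intro c hc e he hce
      rcases Finset.mem_insert.1 hc with rfl | hc' <;> rcases Finset.mem_insert.1 he with rfl | he'
      · exact absurd rfl hce
      · exact hcon e he'
      · rw [norm_sub_rev]; exact hcon c hc'
      · exact hS.2 c hc' e he' hce
  have hle : (insert x S).card ≤ Nat.findGreatest p b := by
    apply Nat.le_findGreatest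
    · exact_mod_cast (hQ _ hQ').trans hb
    · exact ⟨_, hQ', rfl⟩
  rw [Finset.card_insert_of_notMem hxS] at hle
  omega

theorem signForm_add {d : ℕ} (s : Fin d → Bool) (y z : Fin d → ℝ) :
    signForm s (y + z) = signForm s y + signForm s z := by
  simp [signForm, mul_add, Finset.sum_add_distrib]

theorem signForm_smul {d : ℕ} (s : Fin d → Bool) (c : ℝ) (y : Fin d → ℝ) :
    signForm s (c • y) = c * signForm s y := by
  simp only [signForm, Finset.mul_sum, Pi.smul_apply, smul_eq_mul]
  exact Finset.sum_congr rfl fun j _ => by ring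

theorem continuous_signForm {d : ℕ} (s : Fin d → Bool) : Continuous (signForm s) := by
  unfold signForm
  fun_prop

/-- Kashin's theorem: `ℓ₂^d` embeds into `ℓ₁^{552 d}` with distortion bounded independently
of `d`. -/
theorem exists_signs_two_sided (d : ℕ) (hd : 1 ≤ d) :
    ∃ r : Fin (552 * d) → Fin d → Bool, ∀ y : EuclideanSpace ℝ (Fin d),
      ((552 * d : ℕ) : ℝ) / 96 * ‖y‖ ≤ ∑ i, |signForm (r i) y| ∧
      ∑ i, |signForm (r i) y| ≤ 6 * (552 * d : ℕ) * ‖y‖ := by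
  -- Mesh `1/576` makes the net error `6 N / 576 = N / 96`, half of the lower bound `N / 48`; the
  -- net has at most `1153 ^ d` points.
  obtain ⟨S, hS1, hScard, hSnet⟩ := exists_net_sphere d (δ := 1 / 576) (by norm_num)
  have hc : (S.card : ℝ) * ((46 / 47) ^ (552 * d) + (1 / 2) ^ (552 * d)) < 1 := by
    -- `552 = 46 * 12`: the failure probability `2 ^ (-12 d)` beats the size of the net.
    have h1 : ((46 : ℝ) / 47) ^ 552 ≤ 1 / 4096 := by
      have h : ((46 : ℝ) / 47) ^ 46 ≤ 1 / 2 := by norm_num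
      calc ((46 : ℝ) / 47) ^ 552 = (((46 : ℝ) / 47) ^ 46) ^ 12 := by rw [← pow_mul]
        _ ≤ (1 / 2) ^ 12 := by gcongr
        _ = _ := by norm_num
    have h2 : ((1 : ℝ) / 2) ^ 552 ≤ 1 / 4096 :=
      (pow_le_pow_of_le_one (by norm_num) (by norm_num) (show 12 ≤ 552 by norm_num)).trans
        (by norm_num)
    rw [pow_mul, pow_mul]
    calc _ ≤ (1153 : ℝ) ^ d * ((1 / 4096) ^ d + (1 / 4096) ^ d) := by
          gcongr
          exact hScard.trans_eq (by norm_num)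
      _ = 2 * (1153 / 4096) ^ d := by rw [← two_mul, mul_left_comm, ← mul_pow]; norm_num
      _ ≤ 2 * (1153 / 4096) ^ 1 := by
          gcongr ?_ * ?_
          exact pow_le_pow_of_le_one (by norm_num) (by norm_num) hd
      _ < 1 := by norm_num
  generalize 552 * d = N at hc ⊢
  obtain ⟨r, hr⟩ := exists_signs_of_finset S hS1 hc
  refine ⟨r, ?_⟩
  set p : EuclideanSpace ℝ (Fin d) → ℝ := fun y => ∑ i, |signForm (r i) y| with hp
  have padd : ∀ y z, p (y + z) ≤ p y + p z := by
    intro y z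
    simp only [hp, ← Finset.sum_add_distrib]
    refine Finset.sum_le_sum fun i _ => ?_
    rw [show (y + z).ofLp = y.ofLp + z.ofLp from rfl, signForm_add]
    exact abs_add_le _ _
  have psmul : ∀ (c : ℝ) y, p (c • y) = |c| * p y := by
    intro c y
    simp only [hp, Finset.mul_sum]
    refine Finset.sum_congr rfl fun i _ => ?_
    rw [show (c • y).ofLp = c • y.ofLp from rfl, signForm_smul, abs_mul]
  have pcont : Continuous p := by
    refine continuous_finsetSum _ fun i _ => ?_
    exact ((continuous_signForm (r i)).comp (PiLp.continuous_ofLp 2 _)).abs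
  have : Nontrivial (EuclideanSpace ℝ (Fin d)) := by
    have : Nonempty (Fin d) := ⟨⟨0, hd⟩⟩
    infer_instance
  obtain ⟨x0, hx0, hmax⟩ := (isCompact_sphere (0 : EuclideanSpace ℝ (Fin d)) 1).exists_isMaxOn
    (NormedSpace.sphere_nonempty.2 zero_le_one) pcont.continuousOn
  have hhom : ∀ (B : EuclideanSpace ℝ (Fin d)), B ≠ 0 → ∃ u, ‖u‖ = 1 ∧ B = ‖B‖ • u := by
    intro B hB
    refine ⟨‖B‖⁻¹ • B, ?_, ?_⟩
    · rw [norm_smul, norm_inv, norm_norm, inv_mul_cancel₀ (norm_ne_zero_iff.2 hB)]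
    · rw [smul_smul, mul_inv_cancel₀ (norm_ne_zero_iff.2 hB), one_smul]
  have p0 : p 0 = 0 := by simpa using psmul 0 0
  have hA : ∀ z, p z ≤ p x0 * ‖z‖ := by
    intro z
    rcases eq_or_ne z 0 with rfl | hz
    · simp [p0]
    · obtain ⟨u, hu, hz'⟩ := hhom z hz
      have := hmax (show u ∈ Metric.sphere (0 : EuclideanSpace ℝ (Fin d)) 1 by simpa using hu)
      have : p u ≤ p x0 := this
      calc p z = ‖z‖ * p u := by
            conv_lhs => rw [hz']
            rw [psmul, abs_of_nonneg (norm_nonneg z)]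
        _ ≤ ‖z‖ * p x0 := by gcongr
        _ = _ := mul_comm _ _
  have p0nn : 0 ≤ p x0 := Finset.sum_nonneg fun i _ => abs_nonneg _
  -- The maximum bounds itself: `p x0 ≤ 3 N + p x0 / 576`.
  have hA6 : p x0 ≤ 6 * N := by
    obtain ⟨y, hy, hxy⟩ := hSnet x0 (by simpa using hx0)
    have h1 := padd y (x0 - y)
    rw [add_sub_cancel] at h1
    have h2 := hA (x0 - y)
    have h3 := (hr y hy).2
    have h4 : p x0 * ‖x0 - y‖ ≤ p x0 * (1 / 576) := by gcongr
    have h5 : p y ≤ 3 * N := h3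
    have : (0 : ℝ) ≤ N := Nat.cast_nonneg _
    linarith
  have hlow : ∀ u, ‖u‖ = 1 → (N : ℝ) / 96 ≤ p u := by
    intro u hu
    obtain ⟨y, hy, hxy⟩ := hSnet u hu
    have h1 := padd u (y - u)
    rw [add_sub_cancel] at h1
    have h2 := hA (y - u)
    rw [norm_sub_rev] at h2
    have h3 : (N : ℝ) / 48 ≤ p y := (hr y hy).1
    have h4 : p x0 * ‖u - y‖ ≤ 6 * N * (1 / 576) := by gcongr
    linarith
  intro y
  refine ⟨?_, (hA y).trans (by gcongr)⟩
  change _ ≤ p y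
  rcases eq_or_ne y 0 with rfl | hy
  · simp [p0]
  · obtain ⟨u, hu, hy'⟩ := hhom y hy
    calc (N : ℝ) / 96 * ‖y‖ ≤ p u * ‖y‖ := by gcongr; exact hlow u hu
      _ = p y := by
          conv_rhs => rw [hy']
          rw [psmul, abs_of_nonneg (norm_nonneg y), mul_comm]

theorem exists_kashin_frame (d : ℕ) (hd : 1 ≤ d) :
    ∃ e : Fin (552 * d) → EuclideanSpace ℝ (Fin d), ∀ y,
      ‖y‖ ≤ ∑ i, |inner ℝ (e i) y| ∧ ∑ i, |inner ℝ (e i) y| ≤ 576 * ‖y‖ := by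
  have hex := exists_signs_two_sided d hd
  have hN : 0 < 552 * d := by omega
  generalize 552 * d = N at hex hN ⊢
  obtain ⟨r, hr⟩ := hex
  have hNpos : (0 : ℝ) < N := by exact_mod_cast hN
  refine ⟨fun i => WithLp.toLp 2 fun j => 96 / N * (if r i j then 1 else -1), fun y => ?_⟩
  have h : ∀ i, |inner ℝ (WithLp.toLp 2 (fun j => 96 / N * (if r i j then (1 : ℝ) else -1)) :
      EuclideanSpace ℝ (Fin d)) y| = 96 / N * |signForm (r i) y| := by
    intro i
    conv_rhs => rw [← abs_of_pos (show (0 : ℝ) < 96 / N by positivity), ← abs_mul]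
    congr 1
    simp only [PiLp.inner_apply, signForm, Finset.mul_sum, RCLike.inner_apply, conj_trivial]
    exact Finset.sum_congr rfl fun j _ => by ring
  simp only [h, ← Finset.mul_sum]
  obtain ⟨h1, h2⟩ := hr y
  constructor
  · calc ‖y‖ = 96 / N * (N / 96 * ‖y‖) := by field_simp
      _ ≤ _ := by gcongr
  · calc _ ≤ 96 / N * (6 * N * ‖y‖) := by gcongr
      _ = _ := by field_simp; ring

/-! ### Bounded, measurable coefficients by duality -/

/-- Dual form of the upper frame bound: pair the sum with itself. -/
theorem norm_sum_smul_le_of_frame {E : Type*} [NormedAddCommGroup E]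
    [InnerProductSpace ℝ E] {ι : Type*} [Fintype ι] {e : ι → E} {K : ℝ} (he : ∀ y, ∑ i, |inner ℝ (e i) y| ≤ K * ‖y‖)
    {t : ℝ} {v : ι → ℝ} (hK : 0 ≤ K) (ht : 0 ≤ t) (hv : ∀ i, |v i| ≤ t) :
    ‖∑ i, v i • e i‖ ≤ K * t := by
  set x := ∑ i, v i • e i with hx
  have h1 : ‖x‖ * ‖x‖ ≤ K * t * ‖x‖ := by
    rw [← real_inner_self_eq_norm_mul_norm]
    conv_lhs => rw [hx, sum_inner]
    calc ∑ i, inner ℝ (v i • e i) x ≤ ∑ i, t * |inner ℝ (e i) x| := by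
          refine Finset.sum_le_sum fun i _ => ?_
          rw [real_inner_smul_left]
          refine (le_abs_self _).trans ?_
          rw [abs_mul]
          gcongr
          exact hv i
      _ = t * ∑ i, |inner ℝ (e i) x| := by rw [Finset.mul_sum]
      _ ≤ t * (K * ‖x‖) := by gcongr; exact he x
      _ = _ := by ring
  rcases (norm_nonneg x).eq_or_lt with h0 | h0
  · rw [← h0]; positivity
  · exact le_of_mul_le_mul_right h1 h0

section Frame

variable {E : Type*} [NormedAddCommGroup E] [InnerProductSpace ℝ E] [FiniteDimensional ℝ E]
  {ι : Type*} [Fintype ι] {e : ι → E}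

/-- The image of the cube `[-1, 1]^ι` is convex and compact with support function `∑ |⟨e i, y⟩| ≥
‖y‖`, so by Hahn–Banach it contains the unit ball. -/
theorem exists_coeff_of_frame (he : ∀ y, ‖y‖ ≤ ∑ i, |inner ℝ (e i) y|) {x : E} (hx : ‖x‖ ≤ 1) :
    ∃ a : ι → ℝ, (∀ i, |a i| ≤ 1) ∧ ∑ i, a i • e i = x := by
  set L : (ι → ℝ) →ₗ[ℝ] E := Fintype.linearCombination ℝ e with hL
  have hcomp : IsCompact (L '' Set.Icc (-1) 1) :=
    isCompact_Icc.image L.continuous_of_finiteDimensional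
  have hconv : Convex ℝ (L '' Set.Icc (-1) 1) := (convex_Icc _ _).linear_image L
  by_cases hmem : x ∈ L '' Set.Icc (-1) 1
  · obtain ⟨a, ha, hax⟩ := hmem
    refine ⟨a, fun i => abs_le.2 ⟨ha.1 i, ha.2 i⟩, ?_⟩
    rw [← hax, hL, Fintype.linearCombination_apply]
  · exfalso
    obtain ⟨f, u, hf, hu⟩ := geometric_hahn_banach_closed_point hconv hcomp.isClosed hmem
    have : CompleteSpace E := FiniteDimensional.complete ℝ E
    set y := (InnerProductSpace.toDual ℝ E).symm f with hy
    have hfy : ∀ z, f z = inner ℝ y z := fun z =>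
      (InnerProductSpace.toDual_symm_apply (x := z) (y := f)).symm
    -- The sign vector attains the support function.
    have h1 := hf (L fun i => SignType.sign (inner ℝ (e i) y : ℝ)) ⟨_, ⟨fun i => ?_, fun i => ?_⟩, rfl⟩
    · rw [hfy, hL, Fintype.linearCombination_apply, inner_sum] at h1
      have h2 : ∀ i, inner ℝ y (((SignType.sign (inner ℝ (e i) y : ℝ) : ℝ)) • e i)
          = |inner ℝ (e i) y| := by
        intro i
        rw [real_inner_smul_right, real_inner_comm, sign_mul_self]
      simp only [h2] at h1
      have h3 : f x ≤ ‖y‖ := by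
        rw [hfy]
        calc _ ≤ ‖y‖ * ‖x‖ := real_inner_le_norm _ _
          _ ≤ ‖y‖ * 1 := by gcongr
          _ = _ := mul_one _
      linarith [he y]
    · rcases lt_trichotomy (inner ℝ (e i) y : ℝ) 0 with h | h | h <;> simp [h, sign_neg, sign_pos]
    · rcases lt_trichotomy (inner ℝ (e i) y : ℝ) 0 with h | h | h <;> simp [h, sign_neg, sign_pos]

theorem exists_coeff_le_norm_of_frame (he : ∀ y, ‖y‖ ≤ ∑ i, |inner ℝ (e i) y|) (x : E) :
    ∃ a : ι → ℝ, (∀ i, |a i| ≤ ‖x‖) ∧ ∑ i, a i • e i = x := by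
  rcases eq_or_ne x 0 with rfl | hx
  · exact ⟨0, by simp⟩
  · have hx' := norm_ne_zero_iff.2 hx
    obtain ⟨a, ha, hax⟩ := exists_coeff_of_frame he (x := ‖x‖⁻¹ • x)
      (by rw [norm_smul, norm_inv, norm_norm, inv_mul_cancel₀ hx'])
    refine ⟨fun i => ‖x‖ * a i, fun i => ?_, ?_⟩
    · rw [abs_mul, abs_norm]
      exact mul_le_of_le_one_right (norm_nonneg _) (ha i)
    · simp only [mul_smul, ← Finset.smul_sum, hax]
      rw [smul_smul, mul_inv_cancel₀ hx', one_smul]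

/-- The bounded coefficients in a Kashin frame can be chosen measurably. -/
theorem exists_measurable_coeff_of_frame [MeasurableSpace E] [BorelSpace E]
    (he : ∀ y, ‖y‖ ≤ ∑ i, |inner ℝ (e i) y|) :
    ∃ a : E → ι → ℝ, Measurable a ∧ (∀ w, ‖w‖ ≤ 1 → ∀ i, |a w i| ≤ 3) ∧
      ∀ w, ∑ i, a w i • e i = w := by
  choose a₀ ha₀ ha₀' using exists_coeff_le_norm_of_frame he
  obtain ⟨g, hg⟩ := LinearMap.exists_rightInverse_of_surjective
    (Fintype.linearCombination ℝ e : (ι → ℝ) →ₗ[ℝ] E)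
    (LinearMap.range_eq_top.2 fun x => ⟨a₀ x, by
      rw [Fintype.linearCombination_apply]; exact ha₀' x⟩)
  set G : E →L[ℝ] (ι → ℝ) := LinearMap.toContinuousLinearMap g with hG
  have hGr : ∀ x, ∑ i, G x i • e i = x := fun x => by
    have := LinearMap.congr_fun hg x
    rwa [LinearMap.comp_apply, Fintype.linearCombination_apply] at this
  -- Round `w` to a dense sequence, so that arbitrary choices `a₀` become measurable, and correct
  -- linearly by `G`. This `δ` gives coefficients at most `2 + 1`.
  set δ : ℝ := min 1 (1 / (‖G‖ + 1)) with hδ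
  have hδpos : 0 < δ := lt_min one_pos (by positivity)
  have hex : ∀ w : E, ∃ n, dist w (TopologicalSpace.denseSeq E n) < δ := by
    intro w
    exact (TopologicalSpace.denseRange_denseSeq E).exists_dist_lt w hδpos
  classical
  set T : E → ℕ := fun w => Nat.find (hex w) with hT
  have hTm : Measurable T := measurable_find hex fun n =>
    measurableSet_lt (measurable_id.dist measurable_const) measurable_const
  have hTd : ∀ w, ‖w - TopologicalSpace.denseSeq E (T w)‖ < δ := fun w => by
    rw [← dist_eq_norm]; exact Nat.find_spec (hex w)
  set D : E → E := fun w => TopologicalSpace.denseSeq E (T w) with hD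
  have hDm : Measurable D := (measurable_from_nat (f := TopologicalSpace.denseSeq E)).comp hTm
  refine ⟨fun w => a₀ (D w) + G (w - D w), ?_, ?_, ?_⟩
  · have h1 : Measurable fun w => a₀ (D w) :=
      (measurable_from_nat (f := fun n => a₀ (TopologicalSpace.denseSeq E n))).comp hTm
    exact h1.add (G.continuous.measurable.comp (measurable_id.sub hDm))
  · intro w hw i
    have h1 : ‖D w‖ ≤ 2 := by
      have h := norm_sub_norm_le (D w) w
      rw [norm_sub_rev] at h
      have h' := (hTd w).le.trans (min_le_left _ _)
      linarith
    have h2 : |G (w - D w) i| ≤ 1 := by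
      calc |G (w - D w) i| ≤ ‖G (w - D w)‖ := norm_le_pi_norm (G (w - D w)) i
        _ ≤ ‖G‖ * ‖w - D w‖ := G.le_opNorm _
        _ ≤ ‖G‖ * (1 / (‖G‖ + 1)) := by gcongr; exact (hTd w).le.trans (min_le_right _ _)
        _ ≤ 1 := by
            rw [mul_one_div, div_le_one (by positivity)]
            linarith
    calc |(a₀ (D w) + G (w - D w)) i| ≤ |a₀ (D w) i| + |G (w - D w) i| := abs_add_le _ _
      _ ≤ 3 := by linarith [ha₀ (D w) i]
  · intro w
    simp only [Pi.add_apply, add_smul, Finset.sum_add_distrib, ha₀', hGr]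
    abel

end Frame

/-- Kashin's representation with measurable coefficients. -/
theorem exists_kashin_representation :
    ∃ (C : ℕ) (K : ℝ), 1 ≤ K ∧ ∀ d : ℕ, 1 ≤ d →
      ∃ (e : Fin (C * d) → EuclideanSpace ℝ (Fin d))
        (a : EuclideanSpace ℝ (Fin d) → Fin (C * d) → ℝ), Measurable a ∧
        (∀ w, ‖w‖ ≤ 1 → ∀ i, |a w i| ≤ 1) ∧ (∀ w, ∑ i, a w i • e i = w) ∧
        ∀ (t : ℝ) (v : Fin (C * d) → ℝ), 0 ≤ t → (∀ i, |v i| ≤ t) →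
          ‖∑ i, v i • e i‖ ≤ K * t := by
  refine ⟨552, 3 * 576, by norm_num, fun d hd => ?_⟩
  obtain ⟨e, he⟩ := exists_kashin_frame d hd
  obtain ⟨a, ha, ha1, ha2⟩ := exists_measurable_coeff_of_frame (fun y => (he y).1)
  -- The factor `3` moves from the coefficients to the frame.
  refine ⟨fun i => (3 : ℝ) • e i, fun w => (1 / 3 : ℝ) • a w, ha.const_smul (1 / 3 : ℝ), fun w hw i => ?_,
    fun w => ?_, fun t v ht hv => ?_⟩
  · change |(1 / 3 : ℝ) * a w i| ≤ 1
    rw [abs_mul, abs_of_pos (by norm_num : (0 : ℝ) < 1 / 3)]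
    linarith [ha1 w hw i]
  · conv_rhs => rw [← ha2 w]
    refine Finset.sum_congr rfl fun i _ => ?_
    change ((1 / 3 : ℝ) * a w i) • (3 : ℝ) • e i = _
    rw [smul_smul]
    congr 1
    ring
  · simp only [smul_comm (_ : ℝ) (3 : ℝ), ← Finset.smul_sum]
    rw [norm_smul, mul_assoc]
    have := norm_sum_smul_le_of_frame (fun y => (he y).2) (by norm_num) ht hv
    norm_num
    exact this

/-! ### From separating queries to an algorithm -/

/-- A family of queries whose expectations, known up to `2 τ`, determine the mean up to `ε` yields
a non-adaptive algorithm: output the mean of any distribution consistent with the answers. -/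
theorem exists_nonAdaptive_of_separating {E : Type*} [NormedAddCommGroup E] [NormedSpace ℝ E]
    [MeasurableSpace E] {ι : Type*} [Fintype ι] {τ ε : ℝ}
    (φ : ι → Metric.closedBall (0 : E) 1 → ℝ) (hφ : ∀ i, Measurable (φ i))
    (hφ1 : ∀ i x, |φ i x| ≤ 1)
    (hsep : ∀ D D' : Measure (Metric.closedBall (0 : E) 1), IsProbabilityMeasure D →
      IsProbabilityMeasure D' → (∀ i, |∫ x, φ i x ∂D - ∫ x, φ i x ∂D'| ≤ 2 * τ) →
      ‖(∫ w, (w : E) ∂D) - ∫ w, (w : E) ∂D'‖ ≤ ε) :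
    ∃ A : SQAlgorithm (Metric.closedBall (0 : E) 1) E (Fintype.card ι),
      A.NonAdaptive ∧ A.SolvesMeanEstimation τ ε := by
  classical
  let σ := Fintype.equivFin ι
  let P : (Fin (Fintype.card ι) → ℝ) → Measure (Metric.closedBall (0 : E) 1) → Prop :=
    fun v D => IsProbabilityMeasure D ∧ ∀ i, IsSTATAnswer D τ (φ (σ.symm i)) (v i)
  refine ⟨⟨fun i _ => φ (σ.symm i), fun i _ => hφ _, fun i _ x => abs_le.1 (hφ1 _ x),
    -- The value `0` is never used on a genuine transcript, since `D` itself is consistent with it.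
    fun v => if h : ∃ D, P v D then ∫ w, (w : E) ∂h.choose else 0⟩, fun i a a' => rfl, ?_⟩
  intro D hD v hv
  have hex : ∃ D, P v D := ⟨D, hD, hv⟩
  change ‖_ - dite _ _ _‖ ≤ ε
  rw [dif_pos hex]
  obtain ⟨h1, h2⟩ := hex.choose_spec
  refine hsep D _ hD h1 fun i => ?_
  have a1 : |v (σ i) - ∫ x, φ (σ.symm (σ i)) x ∂D| ≤ τ := hv (σ i)
  have a2 : |v (σ i) - ∫ x, φ (σ.symm (σ i)) x ∂hex.choose| ≤ τ := h2 (σ i)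
  rw [σ.symm_apply_apply] at a1 a2
  rw [abs_le] at a1 a2 ⊢
  constructor <;> linarith

/-! ### Truncation and interpolation of norms -/

theorem integrable_of_measurable_of_abs_le {X : Type*} [MeasurableSpace X] {D : Measure X}
    [IsFiniteMeasure D] {f : X → ℝ} (hf : Measurable f) {B : ℝ} (hB : ∀ x, |f x| ≤ B) :
    Integrable f D :=
  Integrable.of_bound hf.aestronglyMeasurable B (Filter.Eventually.of_forall hB)

/-- The truncation of `x` to zero above the level `t`. -/
noncomputable def cutoff (t x : ℝ) : ℝ := if |x| ≤ t then x else 0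

theorem measurable_cutoff (t : ℝ) : Measurable (cutoff t) :=
  Measurable.ite (measurableSet_le measurable_id.abs measurable_const) measurable_id
    measurable_const

theorem abs_cutoff_le {t : ℝ} (ht : 0 ≤ t) (x : ℝ) : |cutoff t x| ≤ t := by
  unfold cutoff
  split_ifs with h
  · exact h
  · simpa using ht

/-- The part of `x` whose absolute value lies in `(s, t]`. -/
noncomputable def band (s t x : ℝ) : ℝ := cutoff t x - cutoff s x

theorem measurable_band (s t : ℝ) : Measurable (band s t) :=
  (measurable_cutoff t).sub (measurable_cutoff s)

theorem band_eq {s t : ℝ} (hst : s ≤ t) (x : ℝ) :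
    band s t x = if s < |x| ∧ |x| ≤ t then x else 0 := by
  unfold band cutoff
  split_ifs with h1 h2 h3 h3 h4 h5 <;> grind

theorem abs_band_le {s t : ℝ} (hs : 0 ≤ s) (hst : s ≤ t) (x : ℝ) : |band s t x| ≤ t := by
  rw [band_eq hst]
  split_ifs with h
  · exact h.2
  · simpa using hs.trans hst

/-- On the band, `1 ≤ (|x| / s) ^ q`; summed over coordinates, this is Markov's count of the large
ones. -/
theorem band_sq_le {s t q : ℝ} (hs : 0 < s) (hst : s ≤ t) (hq : 0 ≤ q) (x : ℝ) :
    band s t x ^ 2 ≤ t ^ 2 * (s ^ q)⁻¹ * |x| ^ q := by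
  rw [band_eq hst]
  split_ifs with h
  · have h1 : s ^ q ≤ |x| ^ q := Real.rpow_le_rpow hs.le h.1.le hq
    have h2 : 1 ≤ (s ^ q)⁻¹ * |x| ^ q := by
      rw [inv_mul_eq_div, one_le_div (by positivity)]
      exact h1
    have h3 : x ^ 2 ≤ t ^ 2 := by
      rw [← sq_abs x]
      gcongr
      exact h.2
    calc x ^ 2 ≤ t ^ 2 * 1 := by linarith
      _ ≤ t ^ 2 * ((s ^ q)⁻¹ * |x| ^ q) := by gcongr
      _ = _ := by ring
  · have := hs.trans_le hst
    simp only [ne_eq, OfNat.ofNat_ne_zero, not_false_eq_true, zero_pow]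
    positivity

/-- Interpolation of `ℓ_q` between `ℓ_∞` and `ℓ₂`. -/
theorem sum_abs_rpow_le_of_abs_le {ι : Type*} [Fintype ι] {f : ι → ℝ} {α β q : ℝ} (hq : 2 < q)
    (hα0 : 0 ≤ α) (hα : ∀ j, |f j| ≤ α) (hβ : ∑ j, f j ^ 2 ≤ β) :
    ∑ j, |f j| ^ q ≤ α ^ (q - 2) * β := by
  calc ∑ j, |f j| ^ q ≤ ∑ j, α ^ (q - 2) * f j ^ 2 := by
        refine Finset.sum_le_sum fun j _ => ?_
        have : |f j| ^ q = |f j| ^ (q - 2) * f j ^ 2 := by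
          rw [← sq_abs (f j), ← Real.rpow_natCast, ← Real.rpow_add_of_nonneg (abs_nonneg _)
            (by linarith) (by norm_num)]
          congr 1
          push_cast
          ring
        rw [this]
        gcongr
        exact hα j
    _ = α ^ (q - 2) * ∑ j, f j ^ 2 := by rw [Finset.mul_sum]
    _ ≤ _ := by gcongr

theorem PiLp.norm_toLp_le_of_sum_rpow_le {q : ℝ≥0∞} {d : ℕ} (hq : 0 < q.toReal)
    {f : Fin d → ℝ} {B : ℝ} (hB : 0 ≤ B)
    (h : ∑ j, |f j| ^ q.toReal ≤ B ^ q.toReal) :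
    ‖(WithLp.toLp q f : PiLp q fun _ : Fin d => ℝ)‖ ≤ B := by
  rw [PiLp.norm_eq_sum hq]
  calc _ ≤ (B ^ q.toReal) ^ (1 / q.toReal) :=
        Real.rpow_le_rpow (Finset.sum_nonneg fun j _ => by positivity) h (by positivity)
    _ = B := by rw [one_div, Real.rpow_rpow_inv hB hq.ne']

/-! ### Error of each band in the `ℓ_q` ball -/

section PiLp

variable {q : ℝ≥0∞} [Fact (1 ≤ q)] {d : ℕ}

theorem PiLp.sum_rpow_le_one (hq : 0 < q.toReal)
    (w : Metric.closedBall (0 : PiLp q fun _ : Fin d => ℝ) 1) :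
    ∑ j, |(w : PiLp q fun _ : Fin d => ℝ) j| ^ q.toReal ≤ 1 := by
  have h : ‖(w : PiLp q fun _ : Fin d => ℝ)‖ ≤ 1 := mem_closedBall_zero_iff.1 w.2
  rw [PiLp.norm_eq_sum hq] at h
  have h0 : 0 ≤ ∑ j, ‖(w : PiLp q fun _ : Fin d => ℝ) j‖ ^ q.toReal :=
    Finset.sum_nonneg fun j _ => by positivity
  have := Real.rpow_le_rpow (by positivity) h hq.le
  rwa [← Real.rpow_mul h0, one_div, inv_mul_cancel₀ hq.ne', Real.rpow_one, Real.one_rpow] at this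

theorem PiLp.abs_coord_le_one (w : Metric.closedBall (0 : PiLp q fun _ : Fin d => ℝ) 1)
    (j : Fin d) : |(w : PiLp q fun _ : Fin d => ℝ) j| ≤ 1 := by
  have h : ‖(w : PiLp q fun _ : Fin d => ℝ)‖ ≤ 1 := mem_closedBall_zero_iff.1 w.2
  exact (PiLp.norm_apply_le (w : PiLp q fun _ : Fin d => ℝ) j).trans h

theorem measurable_coord_closedBall (j : Fin d) :
    Measurable fun w : Metric.closedBall (0 : PiLp q fun _ : Fin d => ℝ) 1 =>
      (w : PiLp q fun _ : Fin d => ℝ) j :=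
  (measurable_pi_apply j).comp ((WithLp.measurable_ofLp q _).comp measurable_subtype_coe)

theorem measurable_band_vector (s t S : ℝ) :
    Measurable fun w : Metric.closedBall (0 : PiLp q fun _ : Fin d => ℝ) 1 =>
      (WithLp.toLp 2 fun j => band s t ((w : PiLp q fun _ : Fin d => ℝ) j) / S :
        EuclideanSpace ℝ (Fin d)) :=
  (WithLp.measurable_toLp 2 _).comp (measurable_pi_lambda _ fun j =>
    ((measurable_band s t).comp (measurable_coord_closedBall j)).div_const S)

/-- The scale that normalizes the part with coordinates in `(s, t]` into the Euclidean ball. -/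
noncomputable def bandScale (q s t : ℝ) : ℝ := t * √((s ^ q)⁻¹)

theorem bandScale_pos {q s t : ℝ} (hs : 0 < s) (ht : 0 < t) : 0 < bandScale q s t := by
  unfold bandScale
  have : 0 < (s ^ q)⁻¹ := by positivity
  positivity

theorem bandScale_sq {q s t : ℝ} (hs : 0 < s) : bandScale q s t ^ 2 = t ^ 2 * (s ^ q)⁻¹ := by
  rw [bandScale, mul_pow, Real.sq_sqrt (by positivity)]

theorem norm_band_vector_le (hq : 0 < q.toReal) {s t : ℝ} (hs : 0 < s) (hst : s ≤ t)
    (w : Metric.closedBall (0 : PiLp q fun _ : Fin d => ℝ) 1) :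
    ‖(WithLp.toLp 2 fun j => band s t ((w : PiLp q fun _ : Fin d => ℝ) j) /
      bandScale q.toReal s t : EuclideanSpace ℝ (Fin d))‖ ≤ 1 := by
  have hS := bandScale_pos (q := q.toReal) hs (hs.trans_le hst)
  rw [← sq_le_one_iff₀ (norm_nonneg _), EuclideanSpace.real_norm_sq_eq]
  simp only [div_pow, ← Finset.sum_div]
  rw [div_le_one (by positivity), bandScale_sq hs]
  calc _ ≤ ∑ j, t ^ 2 * (s ^ q.toReal)⁻¹ * |(w : PiLp q fun _ : Fin d => ℝ) j| ^ q.toReal :=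
        Finset.sum_le_sum fun j _ => band_sq_le hs hst hq.le _
    _ ≤ _ := by
        rw [← Finset.mul_sum]
        exact mul_le_of_le_one_right (by positivity) (PiLp.sum_rpow_le_one hq w)

/-- Coordinate queries and Kashin queries together determine, in `ℓ_q`, the mean of the part of `w`
with coordinates in `(s, t]`. -/
theorem norm_band_mean_sub_le (hq : 2 < q.toReal) {s ρ : ℝ} (hs : 0 < s) (hρ : 1 ≤ ρ)
    {n : ℕ} {e : Fin n → EuclideanSpace ℝ (Fin d)} {a : EuclideanSpace ℝ (Fin d) → Fin n → ℝ}
    {K : ℝ} (hK : 1 ≤ K) (ha : Measurable a) (ha1 : ∀ w, ‖w‖ ≤ 1 → ∀ i, |a w i| ≤ 1)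
    (hae : ∀ w, ∑ i, a w i • e i = w)
    (he : ∀ (t : ℝ) (v : Fin n → ℝ), 0 ≤ t → (∀ i, |v i| ≤ t) → ‖∑ i, v i • e i‖ ≤ K * t)
    {η : ℝ} (hη : 0 ≤ η) (D D' : Measure (Metric.closedBall (0 : PiLp q fun _ : Fin d => ℝ) 1))
    [IsProbabilityMeasure D] [IsProbabilityMeasure D']
    (h1 : ∀ j, |∫ w, band s (ρ * s) ((w : PiLp q fun _ : Fin d => ℝ) j) / (ρ * s) ∂D -
      ∫ w, band s (ρ * s) ((w : PiLp q fun _ : Fin d => ℝ) j) / (ρ * s) ∂D'| ≤ η)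
    (h2 : ∀ i, |∫ w, a (WithLp.toLp 2 fun j => band s (ρ * s) ((w : PiLp q fun _ : Fin d => ℝ) j) /
        bandScale q.toReal s (ρ * s)) i ∂D -
      ∫ w, a (WithLp.toLp 2 fun j => band s (ρ * s) ((w : PiLp q fun _ : Fin d => ℝ) j) /
        bandScale q.toReal s (ρ * s)) i ∂D'| ≤ η) :
    ‖(WithLp.toLp q fun j => ∫ w, band s (ρ * s) ((w : PiLp q fun _ : Fin d => ℝ) j) ∂D -
      ∫ w, band s (ρ * s) ((w : PiLp q fun _ : Fin d => ℝ) j) ∂D' : PiLp q fun _ : Fin d => ℝ)‖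
      ≤ K * ρ * η := by
  set t := ρ * s with ht
  have hst : s ≤ t := le_mul_of_one_le_left hs.le hρ
  have htpos : 0 < t := hs.trans_le hst
  set S := bandScale q.toReal s t with hS
  have hSpos : 0 < S := bandScale_pos hs htpos
  have hq0 : 0 < q.toReal := by linarith
  set Z : Metric.closedBall (0 : PiLp q fun _ : Fin d => ℝ) 1 → EuclideanSpace ℝ (Fin d) :=
    fun w => WithLp.toLp 2 fun j => band s t ((w : PiLp q fun _ : Fin d => ℝ) j) / S with hZ
  have hZm : Measurable Z := measurable_band_vector s t S
  have hint : ∀ (M : Measure (Metric.closedBall (0 : PiLp q fun _ : Fin d => ℝ) 1))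
      [IsProbabilityMeasure M] (i : Fin n), Integrable (fun w => a (Z w) i) M := by
    intro M _ i
    exact integrable_of_measurable_of_abs_le ((measurable_pi_apply i).comp (ha.comp hZm))
      fun w => ha1 _ (norm_band_vector_le hq0 hs hst w) i
  have hcoord : ∀ (M : Measure (Metric.closedBall (0 : PiLp q fun _ : Fin d => ℝ) 1))
      [IsProbabilityMeasure M] (j : Fin d),
      ∫ w, band s t ((w : PiLp q fun _ : Fin d => ℝ) j) ∂M =
        S * ∑ i, (∫ w, a (Z w) i ∂M) * e i j := by
    intro M _ j
    have hw : ∀ w : Metric.closedBall (0 : PiLp q fun _ : Fin d => ℝ) 1,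
        band s t ((w : PiLp q fun _ : Fin d => ℝ) j) = S * ∑ i, a (Z w) i * e i j := by
      intro w
      have h := congrArg (fun x : EuclideanSpace ℝ (Fin d) => x j) (hae (Z w))
      simp only [WithLp.ofLp_sum, Finset.sum_apply, PiLp.smul_apply, smul_eq_mul] at h
      rw [h]
      simp only [hZ]
      field_simp
    simp only [hw]
    rw [integral_const_mul, integral_finsetSum _ fun i _ => (hint M i).mul_const _]
    simp only [integral_mul_const]
  set Δ : Fin d → ℝ := fun j => ∫ w, band s t ((w : PiLp q fun _ : Fin d => ℝ) j) ∂D -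
      ∫ w, band s t ((w : PiLp q fun _ : Fin d => ℝ) j) ∂D' with hΔ
  have hsup : ∀ j, |Δ j| ≤ t * η := by
    intro j
    have := h1 j
    rw [integral_div, integral_div, ← sub_div, abs_div, abs_of_pos htpos,
      div_le_iff₀ htpos] at this
    linarith
  have hl2 : ∑ j, Δ j ^ 2 ≤ (S * (K * η)) ^ 2 := by
    have h3 := he η (fun i => ∫ w, a (Z w) i ∂D - ∫ w, a (Z w) i ∂D') hη h2
    set x := ∑ i, (∫ w, a (Z w) i ∂D - ∫ w, a (Z w) i ∂D') • e i with hx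
    have hxj : ∀ j, Δ j = S * x j := by
      intro j
      simp only [hΔ, hcoord, hx, WithLp.ofLp_sum, Finset.sum_apply, PiLp.smul_apply, smul_eq_mul,
        sub_mul, Finset.sum_sub_distrib, mul_sub]
    simp only [hxj, mul_pow, ← Finset.mul_sum]
    rw [← EuclideanSpace.real_norm_sq_eq]
    rw [← mul_pow K]
    gcongr
  refine PiLp.norm_toLp_le_of_sum_rpow_le hq0 (by positivity) ?_
  refine (sum_abs_rpow_le_of_abs_le hq (by positivity) hsup hl2).trans ?_
  rw [mul_pow S, bandScale_sq hs]
  set p := q.toReal with hp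
  -- The scale `s` cancels here, which makes the error the same for all bands.
  have e1 : (t * η) ^ (p - 2) * (t ^ 2 * (s ^ p)⁻¹ * (K * η) ^ 2) = K ^ 2 * (ρ ^ p * η ^ p) := by
    rcases hη.eq_or_lt with rfl | hη
    · simp [Real.zero_rpow hq0.ne']
    · rw [Real.rpow_sub (by positivity), Real.mul_rpow htpos.le hη.le, ht,
        Real.mul_rpow (by linarith) hs.le, Real.rpow_two]
      have : 0 < s ^ p := by positivity
      have : 0 < ρ := by linarith
      field_simp
  rw [e1, Real.mul_rpow (by positivity) hη, Real.mul_rpow (by positivity) (by positivity),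
    mul_assoc]
  gcongr
  rw [← Real.rpow_two]
  exact Real.rpow_le_rpow_of_exponent_le hK hq.le

/-- An `ℓ_∞` bound costs `d ^ (1/q) ≤ √d` in `ℓ_q`. -/
theorem norm_cutoff_mean_sub_le (hq : 2 < q.toReal) {t : ℝ} (ht : 0 < t) {η : ℝ} (hη : 0 ≤ η)
    (D D' : Measure (Metric.closedBall (0 : PiLp q fun _ : Fin d => ℝ) 1))
    (hd : 1 ≤ d)
    (h : ∀ j, |∫ w, cutoff t ((w : PiLp q fun _ : Fin d => ℝ) j) / t ∂D -
      ∫ w, cutoff t ((w : PiLp q fun _ : Fin d => ℝ) j) / t ∂D'| ≤ η) :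
    ‖(WithLp.toLp q fun j => ∫ w, cutoff t ((w : PiLp q fun _ : Fin d => ℝ) j) ∂D -
      ∫ w, cutoff t ((w : PiLp q fun _ : Fin d => ℝ) j) ∂D' : PiLp q fun _ : Fin d => ℝ)‖
      ≤ √d * t * η := by
  have hq0 : 0 < q.toReal := by linarith
  refine PiLp.norm_toLp_le_of_sum_rpow_le hq0 (by positivity) ?_
  set p := q.toReal with hp
  calc _ ≤ ∑ _j : Fin d, (t * η) ^ p := by
        refine Finset.sum_le_sum fun j _ => ?_
        refine Real.rpow_le_rpow (abs_nonneg _) ?_ hq0.le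
        have := h j
        rw [integral_div, integral_div, ← sub_div, abs_div, abs_of_pos ht, div_le_iff₀ ht] at this
        linarith
    _ = (d : ℝ) * (t * η) ^ p := by simp
    _ ≤ (√d) ^ p * (t * η) ^ p := by
        gcongr
        have h1 : (1 : ℝ) ≤ √d := Real.one_le_sqrt.2 (by exact_mod_cast hd)
        calc (d : ℝ) = √d ^ (2 : ℝ) := by rw [Real.rpow_two, Real.sq_sqrt (by positivity)]
          _ ≤ _ := Real.rpow_le_rpow_of_exponent_le h1 hq.le
    _ = _ := by rw [← Real.mul_rpow (by positivity) (by positivity), mul_assoc]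

/-- The mean splits into the means of the bands and of the remaining small coordinates. -/
theorem mean_sub_eq_sum_bands {ρ : ℝ} (hρ : 0 < ρ) (L : ℕ)
    (D D' : Measure (Metric.closedBall (0 : PiLp q fun _ : Fin d => ℝ) 1))
    [IsProbabilityMeasure D] [IsProbabilityMeasure D'] :
    (∫ w, (w : PiLp q fun _ : Fin d => ℝ) ∂D) - ∫ w, (w : PiLp q fun _ : Fin d => ℝ) ∂D' =
      ∑ k : Fin L, (WithLp.toLp q fun j =>
        ∫ w, band (ρ⁻¹ ^ ((k : ℕ) + 1)) (ρ⁻¹ ^ (k : ℕ)) ((w : PiLp q fun _ : Fin d => ℝ) j) ∂D -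
        ∫ w, band (ρ⁻¹ ^ ((k : ℕ) + 1)) (ρ⁻¹ ^ (k : ℕ)) ((w : PiLp q fun _ : Fin d => ℝ) j) ∂D') +
      WithLp.toLp q fun j => ∫ w, cutoff (ρ⁻¹ ^ L) ((w : PiLp q fun _ : Fin d => ℝ) j) ∂D -
        ∫ w, cutoff (ρ⁻¹ ^ L) ((w : PiLp q fun _ : Fin d => ℝ) j) ∂D' := by
  have hcut : ∀ (M : Measure (Metric.closedBall (0 : PiLp q fun _ : Fin d => ℝ) 1))
      [IsProbabilityMeasure M] (k : ℕ) (j : Fin d), Integrable (fun w :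
        Metric.closedBall (0 : PiLp q fun _ : Fin d => ℝ) 1 =>
        cutoff (ρ⁻¹ ^ k) ((w : PiLp q fun _ : Fin d => ℝ) j)) M := by
    intro M _ k j
    exact integrable_of_measurable_of_abs_le
      ((measurable_cutoff _).comp (measurable_coord_closedBall j))
      fun w => abs_cutoff_le (by positivity) _
  have hmean : ∀ (M : Measure (Metric.closedBall (0 : PiLp q fun _ : Fin d => ℝ) 1))
      [IsProbabilityMeasure M] (j : Fin d),
      (∫ w, (w : PiLp q fun _ : Fin d => ℝ) ∂M) j =
      ∑ k : Fin L, ∫ w, band (ρ⁻¹ ^ ((k : ℕ) + 1)) (ρ⁻¹ ^ (k : ℕ))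
        ((w : PiLp q fun _ : Fin d => ℝ) j) ∂M +
      ∫ w, cutoff (ρ⁻¹ ^ L) ((w : PiLp q fun _ : Fin d => ℝ) j) ∂M := by
    intro M _ j
    rw [eval_integral_piLp fun j => integrable_of_measurable_of_abs_le
      (measurable_coord_closedBall j) fun w => PiLp.abs_coord_le_one w j]
    have hb : ∀ k : ℕ, ∫ w, band (ρ⁻¹ ^ (k + 1)) (ρ⁻¹ ^ k)
        ((w : PiLp q fun _ : Fin d => ℝ) j) ∂M =
        ∫ w, cutoff (ρ⁻¹ ^ k) ((w : PiLp q fun _ : Fin d => ℝ) j) ∂M -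
        ∫ w, cutoff (ρ⁻¹ ^ (k + 1)) ((w : PiLp q fun _ : Fin d => ℝ) j) ∂M := by
      intro k
      exact integral_sub (hcut M k j) (hcut M (k + 1) j)
    simp only [hb]
    rw [Fin.sum_univ_eq_sum_range (fun k =>
      ∫ w, cutoff (ρ⁻¹ ^ k) ((w : PiLp q fun _ : Fin d => ℝ) j) ∂M -
        ∫ w, cutoff (ρ⁻¹ ^ (k + 1)) ((w : PiLp q fun _ : Fin d => ℝ) j) ∂M),
      Finset.sum_range_sub', sub_add_cancel]
    refine integral_congr_ae (Filter.Eventually.of_forall fun w => ?_)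
    simp only [pow_zero, cutoff]
    -- The sum telescopes to the cutoff at level `1`, which is the identity on the ball.
    rw [if_pos (PiLp.abs_coord_le_one w j)]
  ext j
  simp only [PiLp.sub_apply, PiLp.add_apply, WithLp.ofLp_sum, Finset.sum_apply, hmean,
    Finset.sum_sub_distrib]
  ring

end PiLp

/-! ### Choice of parameters -/

theorem mainTheorem2 :
    ∃ c : ℝ, 0 < c ∧
      ∀ (q : ℝ≥0∞) [Fact (1 ≤ q)], 2 < q → q < ⊤ →
        ∀ d : ℕ, 2 ≤ d → ∀ ε : ℝ, 0 < ε →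
          ∃ (m : ℕ) (A : SQAlgorithm
              (Metric.closedBall (0 : PiLp q fun _ : Fin d => ℝ) 1)
              (PiLp q fun _ : Fin d => ℝ) m),
            (m : ℝ) ≤ 3 * d * Real.logb 2 d ∧
            A.NonAdaptive ∧
            A.SolvesMeanEstimation (c * ε / Real.logb 2 d) ε := by
  obtain ⟨C, K, hK, hkashin⟩ := exists_kashin_representation
  -- A band costs `(C + 1) d` queries; this `ρ` makes `L (C + 1) ≤ (log₂ d) / 2`.
  set ρ : ℝ := 2 ^ (C + 1) with hρ
  have hρ1 : 1 ≤ ρ := one_le_pow₀ one_le_two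
  have hρ0 : 0 < ρ := by positivity
  -- The bands and the remainder contribute at most `2 τ l K ρ` and `2 τ l ρ`, which add up to `ε`.
  refine ⟨1 / (2 * ρ * (K + 1)), by positivity, ?_⟩
  intro q _ hq hqt d hd ε hε
  have hq2 : 2 < q.toReal := by
    have := (ENNReal.toReal_lt_toReal (by simp) hqt.ne).2 hq
    simpa using this
  have hq0 : 0 < q.toReal := by linarith
  obtain ⟨e, a, ha, ha1, hae, he⟩ := hkashin d (by omega)
  set l := Real.logb 2 d with hl
  have hl1 : 1 ≤ l := by
    rw [hl, Real.le_logb_iff_rpow_le one_lt_two (by positivity)]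
    simpa using (by exact_mod_cast hd : (2 : ℝ) ≤ d)
  set L : ℕ := ⌊l / (2 * (C + 1))⌋₊ with hL
  have hLle : (L : ℝ) ≤ l / (2 * (C + 1)) := Nat.floor_le (by positivity)
  have hLl : (L : ℝ) ≤ l := hLle.trans (div_le_self (by linarith) (by
    have : (0 : ℝ) ≤ C := Nat.cast_nonneg C
    linarith))
  -- The floor gives `L + 1 > l / (2 (C + 1))`, hence `ρ ^ (L + 1) ≥ 2 ^ (l / 2) = √d`.
  have hdρ : √d ≤ ρ ^ (L + 1) := by
    have h1 : l / (2 * (C + 1)) < L + 1 := Nat.lt_floor_add_one _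
    rw [div_lt_iff₀ (by positivity)] at h1
    have h2 : (d : ℝ) = 2 ^ l := (Real.rpow_logb two_pos (by norm_num) (by positivity)).symm
    rw [Real.sqrt_le_left (by positivity), h2, hρ, ← pow_mul, ← pow_mul, ← Real.rpow_natCast]
    apply Real.rpow_le_rpow_of_exponent_le one_le_two
    push_cast
    linarith
  set s : ℕ → ℝ := fun k => ρ⁻¹ ^ (k + 1) with hs
  have hspos : ∀ k, 0 < s k := fun k => by positivity
  have hst : ∀ k, ρ⁻¹ ^ k = ρ * s k := fun k => by simp only [hs, pow_succ]; field_simp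
  set τ := 1 / (2 * ρ * (K + 1)) * ε / l with hτ
  have hτ0 : 0 ≤ τ := by positivity
  let φ : Fin d ⊕ (Fin L × (Fin d ⊕ Fin (C * d))) →
      Metric.closedBall (0 : PiLp q fun _ : Fin d => ℝ) 1 → ℝ := fun i w => match i with
    | .inl j => cutoff (ρ⁻¹ ^ L) ((w : PiLp q fun _ : Fin d => ℝ) j) / ρ⁻¹ ^ L
    | .inr (k, .inl j) => band (s k) (ρ * s k) ((w : PiLp q fun _ : Fin d => ℝ) j) / (ρ * s k)
    | .inr (k, .inr i) => a (WithLp.toLp 2 fun j =>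
        band (s k) (ρ * s k) ((w : PiLp q fun _ : Fin d => ℝ) j) /
          bandScale q.toReal (s k) (ρ * s k)) i
  have hss : ∀ k, s k ≤ ρ * s k := fun k => le_mul_of_one_le_left (hspos k).le hρ1
  have hφm : ∀ i, Measurable (φ i) := by
    rintro (j | ⟨k, j | i⟩)
    · exact ((measurable_cutoff _).comp (measurable_coord_closedBall j)).div_const _
    · exact ((measurable_band _ _).comp (measurable_coord_closedBall j)).div_const _
    · exact (measurable_pi_apply i).comp (ha.comp (measurable_band_vector _ _ _))
  have hφ1 : ∀ i w, |φ i w| ≤ 1 := by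
    rintro (j | ⟨k, j | i⟩) w
    · change |cutoff _ _ / _| ≤ 1
      have ht : 0 < ρ⁻¹ ^ L := by positivity
      rw [abs_div, abs_of_pos ht, div_le_one ht]
      exact abs_cutoff_le ht.le _
    · change |band _ _ _ / _| ≤ 1
      have ht : 0 < ρ * s k := mul_pos hρ0 (hspos k)
      rw [abs_div, abs_of_pos ht, div_le_one ht]
      exact abs_band_le (hspos k).le (hss k) _
    · exact ha1 _ (norm_band_vector_le hq0 (hspos k) (hss k) w) i
  have hsep : ∀ D D' : Measure (Metric.closedBall (0 : PiLp q fun _ : Fin d => ℝ) 1),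
      IsProbabilityMeasure D → IsProbabilityMeasure D' →
      (∀ i, |∫ x, φ i x ∂D - ∫ x, φ i x ∂D'| ≤ 2 * τ) →
      ‖(∫ w, (w : PiLp q fun _ : Fin d => ℝ) ∂D) - ∫ w, (w : PiLp q fun _ : Fin d => ℝ) ∂D'‖
        ≤ ε := by
    intro D D' _ _ hDD
    rw [mean_sub_eq_sum_bands hρ0 L D D']
    have hη : 0 ≤ 2 * τ := by positivity
    have b1 : ∀ k : Fin L, ‖(WithLp.toLp q fun j =>
        ∫ w, band (ρ⁻¹ ^ ((k : ℕ) + 1)) (ρ⁻¹ ^ (k : ℕ)) ((w : PiLp q fun _ : Fin d => ℝ) j) ∂D -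
        ∫ w, band (ρ⁻¹ ^ ((k : ℕ) + 1)) (ρ⁻¹ ^ (k : ℕ)) ((w : PiLp q fun _ : Fin d => ℝ) j) ∂D' :
        PiLp q fun _ : Fin d => ℝ)‖ ≤ K * ρ * (2 * τ) := by
      intro k
      rw [hst k]
      exact norm_band_mean_sub_le hq2 (hspos k) hρ1 hK ha ha1 hae he hη D D'
        (fun j => hDD (.inr (k, .inl j))) (fun i => hDD (.inr (k, .inr i)))
    have b2 := norm_cutoff_mean_sub_le hq2 (t := ρ⁻¹ ^ L) (by positivity) hη D D' (by omega)
      (fun j => hDD (.inl j))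
    have b3 : √d * ρ⁻¹ ^ L ≤ ρ := by
      calc √d * ρ⁻¹ ^ L ≤ ρ ^ (L + 1) * ρ⁻¹ ^ L := by gcongr
        _ = ρ := by
          rw [pow_succ', mul_assoc, ← mul_pow, mul_inv_cancel₀ hρ0.ne', one_pow, mul_one]
    calc _ ≤ ∑ k : Fin L, K * ρ * (2 * τ) + √d * ρ⁻¹ ^ L * (2 * τ) :=
          (norm_add_le _ _).trans (add_le_add
            ((norm_sum_le _ _).trans (Finset.sum_le_sum fun k _ => b1 k)) b2)
      _ ≤ l * (K * ρ * (2 * τ)) + l * ρ * (2 * τ) := by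
          rw [Finset.sum_const, Finset.card_univ, Fintype.card_fin, nsmul_eq_mul]
          gcongr ?_ * _ + ?_ * _
          exact b3.trans (le_mul_of_one_le_left hρ0.le hl1)
      _ = ε := by
          rw [hτ]
          field_simp
  obtain ⟨A, hA1, hA2⟩ := exists_nonAdaptive_of_separating φ hφm hφ1 hsep
  refine ⟨_, A, ?_, hA1, hA2⟩
  simp only [Fintype.card_sum, Fintype.card_prod, Fintype.card_fin]
  push_cast
  rw [le_div_iff₀ (by positivity)] at hLle
  have hd0 : (0 : ℝ) < d := by positivity
  -- The count is `d + L (C + 1) d ≤ d + d l / 2`, and `l ≥ 1`.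
  nlinarith
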